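/- Let $\Lambda_\oplus$ be the untyped $\lambda$-calculus with fair binary probabilistic choice, $M ::= x \mid \lambda x.M \mid MN \mid M\oplus N$ (terms up to renaming of bound variables), and let values be the closed abstractions. The call-by-name semantics $[\![M]\!]$ of a closed term $M$ is the pointwise supremum of all $\mathscr D$ with $M\Downarrow\mathscr D$, where $\Downarrow$ is given inductively by: $M\Downarrow 0$; $V\Downarrow\{V\}$ (the point mass) for values $V$; if $M\Downarrow\mathscr D$ and $P[N/x]\Downarrow\mathscr E_{P}$ for all $\lambda x.P$ in the support of $\mathscr D$, then $MN\Downarrow\sum_{\lambda x.P}\mathscr D(\lambda x.P)\,\mathscr E_{P}$; if $M\Downarrow\mathscr D$ and $N\Downarrow\mathscr E$, then $M\oplus N\Downarrow\frac12\mathscr D+\frac12\mathscr E$. Write $|M|=\sum_V[\![M]\!](V)$. * Context preorder and equivalence, for terms $M,N$ with free variables in a finite set $\overline x$: $M\leq_\oplus N$ iff $|C[M]|\le|C[N]|$ for every one-hole context $C$ (whose binders may capture variables) that closes all terms over $\overline x$; $M\simeq_\oplus N$ iff $M\leq_\oplus N$ and $N\leq_\oplus M$. * Applicative (bi)similarity.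 Consider the labelled Markov chain whose states are the closed terms together with a disjoint copy $\nu x.P$ of each value $\lambda x.P$ (distinguished values), whose labels are $\tau$ and the closed terms, and whose transition probabilities are $\mathcal P(M,\tau,\nu x.P)=[\![M]\!](\lambda x.P)$, $\mathcal P(\nu x.P,L,P[L/x])=1$, and $0$ otherwise. A simulation is a preorder $\mathcal R$ on states, relating only terms with terms and distinguished values with distinguished values, such that $s\mathrel{\mathcal R}t$ implies $\mathcal P(s,\ell,X)\le\mathcal P(t,\ell,\mathcal R(X))$ for all labels $\ell$ and all sets $X$ of states; a bisimulation is an equivalence relation $\mathcal R$ respecting the two sorts such that $s\mathrel{\mathcal R}t$ implies $\mathcal P(s,\ell,E)=\mathcal P(t,\ell,E)$ for all $\ell$ and all equivalence classes $E$ of $\mathcal R$. Closed $M,N$ satisfy $M\lesssim N$ (resp. $M\sim N$) if they are related by some simulation (resp. bisimulation); both relations are extended to open terms by requiring them for all closing substitutions. * CIU preorder. A closed frame stack is a finite list of closed terms. Let $(S,MN)\leadsto(N::S,M)$; $(S,M\oplus N)\leadsto(S,M),(S,N)$; $(N::S,\lambda x.P)\leadsto(S,P[N/x])$. Let $(S,M)\downarrow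 p$ be given inductively by: $(S,M)\downarrow 0$; $(\mathrm{nil},V)\downarrow 1$ for values $V$; if $(S,M)\leadsto(T_1,N_1),\dots,(T_n,N_n)$ and $(T_i,N_i)\downarrow p_i$ for all $i$, then $(S,M)\downarrow\frac1n\sum_{i=1}^n p_i$. For closed $M,N$, $M\preceq^{\mathsf{CIU}}N$ iff $\sup\{p:(S,M)\downarrow p\}\le\sup\{p:(S,N)\downarrow p\}$ for every closed frame stack $S$. Then applicative similarity (resp. bisimilarity) is strictly finer than the context preorder (resp. context equivalence): for all, possibly open, terms, $M\lesssim N$ implies $M\leq_\oplus N$ and $M\sim N$ implies $M\simeq_\oplus N$, and both converse implications fail, already for closed terms. Concretely, for $$M=\lambda x.\lambda y.(x\oplus y),\qquad N=(\lambda x.\lambda y.x)\oplus(\lambda x.\lambda y.y),$$ one has $M\preceq^{\mathsf{CIU}}N$ and $M\leq_\oplus N$, but not $M\lesssim N$. -/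

import Mathlib

open scoped ENNReal

noncomputable section

namespace ProbLam

/-! ## Terms -/

/-- `Tm n` is the set of terms, up to renaming of bound variables, whose free variables are among
`n` given variables (well-scoped de Bruijn syntax). Closed terms are the elements of `Tm 0`. -/
inductive Tm : ℕ → Type
  | var {n : ℕ} (i : Fin n) : Tm n
  | lam {n : ℕ} (M : Tm (n + 1)) : Tm n
  | app {n : ℕ} (M N : Tm n) : Tm n
  | choice {n : ℕ} (M N : Tm n) : Tm n

namespace Tm

/-- Renaming of the free variables. -/
def rename : {n m : ℕ} → (Fin n → Fin m) → Tm n → Tm m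
  | _, _, ρ, var i => var (ρ i)
  | _, _, ρ, lam M => lam (rename (Fin.cases 0 (fun i => (ρ i).succ)) M)
  | _, _, ρ, app M N => app (rename ρ M) (rename ρ N)
  | _, _, ρ, choice M N => choice (rename ρ M) (rename ρ N)

/-- A substitution moved under a binder. -/
def up {n m : ℕ} (σ : Fin n → Tm m) : Fin (n + 1) → Tm (m + 1) :=
  Fin.cases (var 0) (fun i => rename Fin.succ (σ i))

/-- Simultaneous capture-avoiding substitution. -/
def subst : {n m : ℕ} → (Fin n → Tm m) → Tm n → Tm m
  | _, _, σ, var i => σ i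
  | _, _, σ, lam M => lam (subst (up σ) M)
  | _, _, σ, app M N => app (subst σ M) (subst σ N)
  | _, _, σ, choice M N => choice (subst σ M) (subst σ N)

/-- `P.inst L` is `P[L/x]`, for `P` with at most the free variable `x` and `L` closed. -/
def inst (P : Tm 1) (L : Tm 0) : Tm 0 := P.subst (fun _ => L)

/-- An injective numbering of terms. -/
def code : {n : ℕ} → Tm n → ℕ
  | _, var i => Nat.pair 0 i
  | _, lam M => Nat.pair 1 (code M)
  | _, app M N => Nat.pair 2 (Nat.pair (code M) (code N))
  | _, choice M N => Nat.pair 3 (Nat.pair (code M) (code N))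

theorem code_injective {n : ℕ} : Function.Injective (code : Tm n → ℕ) := by
  intro M
  induction M with
  | var i => intro N h; cases N <;> simp_all [code, Nat.pair_eq_pair, Fin.ext_iff]
  | lam M ih =>
    intro N h
    cases N <;> simp only [code, Nat.pair_eq_pair] at h <;> try omega
    rw [ih h.2]
  | app M₁ M₂ ih₁ ih₂ =>
    intro N h
    cases N <;> simp only [code, Nat.pair_eq_pair] at h <;> try omega
    rw [ih₁ h.2.1, ih₂ h.2.2]
  | choice M₁ M₂ ih₁ ih₂ =>
    intro N h
    cases N <;> simp only [code, Nat.pair_eq_pair] at h <;> try omega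
    rw [ih₁ h.2.1, ih₂ h.2.2]

instance countable {n : ℕ} : Countable (Tm n) := code_injective.countable

end Tm

/-! ## Call-by-name semantics -/

/-- Values are the closed abstractions; `λx.P` is represented by its body `P : Tm 1`. -/
abbrev Val : Type := Tm 1

/-- Value distributions are functions on values; that their total mass is at most one is
`BigStep.sum_le_one` and `sum_sem_le_one`. -/
abbrev Dist : Type := Val → ℝ≥0∞

open Classical in
/-- Big-step call-by-name approximation semantics `M ⇓ D`. -/
inductive BigStep : Tm 0 → Dist → Prop
  | bt (M : Tm 0) : BigStep M 0
  | bv (P : Val) : BigStep (Tm.lam P) (Pi.single P 1)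
  | ba (M N : Tm 0) (D : Dist) (E : Val → Dist) :
      BigStep M D → (∀ P : Val, D P ≠ 0 → BigStep (P.inst N) (E P)) →
      BigStep (Tm.app M N) (fun V => ∑' P : Val, D P * E P V)
  | bs (M N : Tm 0) (D E : Dist) :
      BigStep M D → BigStep N E →
      BigStep (Tm.choice M N) (fun V => 2⁻¹ * D V + 2⁻¹ * E V)

/-- `⟦M⟧`, the pointwise supremum of the approximations of `M`. -/
def sem (M : Tm 0) : Dist := fun V => ⨆ D : {D : Dist // BigStep M D}, D.1 V

/-- `∑ ⟦M⟧`, the probability of convergence of `M`. -/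
def convProb (M : Tm 0) : ℝ≥0∞ := ∑' V : Val, sem M V

theorem BigStep.sum_le_one {M : Tm 0} {D : Dist} (h : BigStep M D) : ∑' V, D V ≤ 1 := by
  classical
  induction h with
  | bt M => simp
  | bv P =>
    rw [tsum_eq_single P (fun b hb => by simp [hb])]
    simp
  | ba M N D E hM hE ihM ihE =>
    rw [ENNReal.tsum_comm]
    refine le_trans (ENNReal.tsum_le_tsum fun P => ?_) ihM
    rw [ENNReal.tsum_mul_left]
    by_cases hP : D P = 0
    · simp [hP]
    · calc D P * ∑' V, E P V ≤ D P * 1 := by gcongr; exact ihE P hP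
        _ = D P := mul_one _
  | bs M N D E hM hN ihM ihN =>
    rw [ENNReal.tsum_add, ENNReal.tsum_mul_left, ENNReal.tsum_mul_left]
    calc 2⁻¹ * ∑' V, D V + 2⁻¹ * ∑' V, E V ≤ 2⁻¹ * 1 + 2⁻¹ * 1 := by gcongr
      _ = (1 : ℝ≥0∞) := by simp [ENNReal.inv_two_add_inv_two]

theorem BigStep.directed {M : Tm 0} {D : Dist} (h : BigStep M D) :
    ∀ {D' : Dist}, BigStep M D' → ∃ D'', BigStep M D'' ∧ D ≤ D'' ∧ D' ≤ D'' := by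
  classical
  induction h with
  | bt M => intro D' h'; exact ⟨D', h', fun V => by simp, le_rfl⟩
  | bv P =>
    intro D' h'
    cases h' with
    | bt => exact ⟨_, BigStep.bv P, le_rfl, fun V => by simp⟩
    | bv => exact ⟨_, BigStep.bv P, le_rfl, le_rfl⟩
  | ba M N D E hM hE ihM ihE =>
    intro D' h'
    cases h' with
    | bt => exact ⟨_, BigStep.ba M N D E hM hE, le_rfl, fun V => by simp⟩
    | ba _ _ D₂ E₂ hM₂ hE₂ =>
      obtain ⟨D₃, hM₃, h₁, h₂⟩ := ihM hM₂
      have key : ∀ P : Val, ∃ F : Dist, BigStep (P.inst N) F ∧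
          (D P ≠ 0 → E P ≤ F) ∧ (D₂ P ≠ 0 → E₂ P ≤ F) := by
        intro P
        by_cases hP : D P = 0 <;> by_cases hP₂ : D₂ P = 0
        · exact ⟨0, BigStep.bt _, by simp [hP], by simp [hP₂]⟩
        · exact ⟨E₂ P, hE₂ P hP₂, by simp [hP], fun _ => le_rfl⟩
        · exact ⟨E P, hE P hP, fun _ => le_rfl, by simp [hP₂]⟩
        · obtain ⟨F, hF, a, b⟩ := ihE P hP (hE₂ P hP₂)
          exact ⟨F, hF, fun _ => a, fun _ => b⟩
      choose F hF hF₁ hF₂ using key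
      refine ⟨_, BigStep.ba M N D₃ F hM₃ (fun P _ => hF P), fun V => ?_, fun V => ?_⟩
      · refine ENNReal.tsum_le_tsum fun P => ?_
        by_cases hP : D P = 0
        · simp [hP]
        · exact mul_le_mul' (h₁ P) (hF₁ P hP V)
      · refine ENNReal.tsum_le_tsum fun P => ?_
        by_cases hP : D₂ P = 0
        · simp [hP]
        · exact mul_le_mul' (h₂ P) (hF₂ P hP V)
  | bs M N D E hM hN ihM ihN =>
    intro D' h'
    cases h' with
    | bt => exact ⟨_, BigStep.bs M N D E hM hN, le_rfl, fun V => by simp⟩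
    | bs _ _ D₂ E₂ hM₂ hN₂ =>
      obtain ⟨D₃, hM₃, a₁, a₂⟩ := ihM hM₂
      obtain ⟨E₃, hN₃, b₁, b₂⟩ := ihN hN₂
      refine ⟨_, BigStep.bs M N D₃ E₃ hM₃ hN₃, fun V => ?_, fun V => ?_⟩
      · exact add_le_add (mul_le_mul' le_rfl (a₁ V)) (mul_le_mul' le_rfl (b₁ V))
      · exact add_le_add (mul_le_mul' le_rfl (a₂ V)) (mul_le_mul' le_rfl (b₂ V))

theorem sum_sem_le_one (M : Tm 0) : ∑' V, sem M V ≤ 1 := by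
  rw [ENNReal.tsum_eq_iSup_sum]
  refine iSup_le fun s => ?_
  unfold sem
  rw [ENNReal.finsetSum_iSup]
  · exact iSup_le fun D => (ENNReal.sum_le_tsum s).trans D.2.sum_le_one
  · intro D₁ D₂
    obtain ⟨D₃, h₃, a, b⟩ := D₁.2.directed D₂.2
    exact ⟨⟨D₃, h₃⟩, fun V => ⟨a V, b V⟩⟩

/-! ## Contexts and the context preorder -/

/-- `Ctx n m`: contexts with a unique hole which, when the hole is filled with a term having free
variables among `n` given ones, yield a term with free variables among `m` given ones.
The hole records which of the variables in scope at its position are the `n` distinct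
variables of the term plugged in; these may thus be captured by binders above the hole. -/
inductive Ctx (n : ℕ) : ℕ → Type
  | hole {m : ℕ} (ρ : Fin n ↪ Fin m) : Ctx n m
  | lam {m : ℕ} (C : Ctx n (m + 1)) : Ctx n m
  | appL {m : ℕ} (C : Ctx n m) (M : Tm m) : Ctx n m
  | appR {m : ℕ} (M : Tm m) (C : Ctx n m) : Ctx n m
  | choiceL {m : ℕ} (C : Ctx n m) (M : Tm m) : Ctx n m
  | choiceR {m : ℕ} (M : Tm m) (C : Ctx n m) : Ctx n m

/-- `C.fill M` is `C[M]`. -/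
def Ctx.fill {n : ℕ} : {m : ℕ} → Ctx n m → Tm n → Tm m
  | _, .hole ρ, M => M.rename ρ
  | _, .lam C, M => .lam (C.fill M)
  | _, .appL C N, M => .app (C.fill M) N
  | _, .appR N C, M => .app N (C.fill M)
  | _, .choiceL C N, M => .choice (C.fill M) N
  | _, .choiceR N C, M => .choice N (C.fill M)

/-- Relations between (possibly open) terms over the same free variables. -/
abbrev TermRel : Type := ∀ n : ℕ, Tm n → Tm n → Prop

/-- The probabilistic context preorder: quantification over all closing contexts. -/
def ctxLE : TermRel := fun n M N => ∀ C : Ctx n 0, convProb (C.fill M) ≤ convProb (C.fill N)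

/-- Probabilistic context equivalence. -/
def ctxEquiv : TermRel := fun n M N => ctxLE n M N ∧ ctxLE n N M

/-! ## Labelled Markov chains, simulations and bisimulations -/

/-- Labelled Markov chains with states `S` and labels `L`. -/
structure LMC (S L : Type) [Countable S] where
  P : S → L → S → ℝ≥0∞
  sum_le_one : ∀ s l, ∑' t, P s l t ≤ 1

/-- `P(s, l, X)`. -/
def LMC.prob {S L : Type} [Countable S] (K : LMC S L) (s : S) (l : L) (X : Set S) : ℝ≥0∞ :=
  ∑' t : X, K.P s l t

/-- Probabilistic simulations: preorders with `P(s,l,X) ≤ P(t,l,R(X))` whenever `s R t`. -/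
structure LMC.IsSimulation {S L : Type} [Countable S] (K : LMC S L) (R : S → S → Prop) :
    Prop where
  refl : ∀ s, R s s
  trans : ∀ s t u, R s t → R t u → R s u
  step : ∀ s t, R s t → ∀ (l : L) (X : Set S), K.prob s l X ≤ K.prob t l {y | ∃ x ∈ X, R x y}

/-- Probabilistic bisimulations: equivalences with `P(s,l,E) = P(t,l,E)` for every equivalence
class `E` whenever `s R t`. -/
structure LMC.IsBisimulation {S L : Type} [Countable S] (K : LMC S L) (R : S → S → Prop) :
    Prop where
  equiv : Equivalence R
  step : ∀ s t, R s t → ∀ (l : L) (u : S), K.prob s l {v | R u v} = K.prob t l {v | R u v}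

/-- States: closed terms (`Sum.inl`) and distinguished values `νx.P` (`Sum.inr P`). -/
abbrev State : Type := Tm 0 ⊕ Val

/-- Labels: `τ` (evaluation) and closed terms (parameter passing). -/
inductive Label : Type
  | tau : Label
  | arg (L : Tm 0) : Label

open Classical in
/-- The transition matrix of the calculus. -/
def trans : State → Label → State → ℝ≥0∞
  | .inl M, .tau, .inr V => sem M V
  | .inr V, .arg L, .inl Q => if Q = V.inst L then 1 else 0
  | _, _, _ => 0

theorem sum_trans_le_one (s : State) (l : Label) : ∑' t, trans s l t ≤ 1 := by
  classical
  rw [Summable.tsum_sum ENNReal.summable ENNReal.summable]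
  rcases s with M | V <;> rcases l with _ | L <;> simp [trans, sum_sem_le_one]

/-- The calculus as a labelled Markov chain. -/
def lambdaChain : LMC State Label where
  P := trans
  sum_le_one := sum_trans_le_one

/-- The chain is multisorted: only states of the same sort may be related. -/
def SortRespecting (R : State → State → Prop) : Prop :=
  ∀ s t, R s t → s.isLeft = t.isLeft

/-- Probabilistic applicative similarity on closed terms. -/
def similar (M N : Tm 0) : Prop :=
  ∃ R : State → State → Prop,
    lambdaChain.IsSimulation R ∧ SortRespecting R ∧ R (.inl M) (.inl N)

/-- Probabilistic applicative bisimilarity on closed terms. -/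
def bisimilar (M N : Tm 0) : Prop :=
  ∃ R : State → State → Prop,
    lambdaChain.IsBisimulation R ∧ SortRespecting R ∧ R (.inl M) (.inl N)

/-- Extension of a relation on closed terms to open terms by closing substitutions. -/
def openExt (R : Tm 0 → Tm 0 → Prop) : TermRel :=
  fun n M N => ∀ σ : Fin n → Tm 0, R (M.subst σ) (N.subst σ)

/-! ## The CIU preorder -/

/-- Closed frame stacks; the head of the list is the topmost frame. -/
abbrev FrameStack : Type := List (Tm 0)

/-- One-step reduction of a pair (frame stack, term) to a sequence of such pairs. -/
inductive StackStep : FrameStack × Tm 0 → List (FrameStack × Tm 0) → Prop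
  | push (S : FrameStack) (M N : Tm 0) : StackStep (S, .app M N) [(N :: S, M)]
  | choice (S : FrameStack) (M N : Tm 0) : StackStep (S, .choice M N) [(S, M), (S, N)]
  | pop (S : FrameStack) (M : Tm 0) (P : Val) : StackStep (M :: S, .lam P) [(S, P.inst M)]

/-- `StackConv S M p`: the pair `(S, M)` is approximated to converge with probability `p`. -/
inductive StackConv : FrameStack → Tm 0 → ℝ≥0∞ → Prop
  | empty (S : FrameStack) (M : Tm 0) : StackConv S M 0
  | value (P : Val) : StackConv [] (.lam P) 1
  | term (S : FrameStack) (M : Tm 0) (cs : List (FrameStack × Tm 0))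
      (p : Fin cs.length → ℝ≥0∞) :
      StackStep (S, M) cs → (∀ i, StackConv (cs.get i).1 (cs.get i).2 (p i)) →
      StackConv S M ((cs.length : ℝ≥0∞)⁻¹ * ∑ i, p i)

/-- The supremum of the `p` with `StackConv S M p`. -/
def stackConvProb (S : FrameStack) (M : Tm 0) : ℝ≥0∞ :=
  ⨆ p : {p : ℝ≥0∞ // StackConv S M p}, p.1

/-- The CIU preorder on closed terms. -/
def ciuLE (M N : Tm 0) : Prop := ∀ S : FrameStack, stackConvProb S M ≤ stackConvProb S N

/-! ## The two terms -/

/-- `λx.λy.(x ⊕ y)` -/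
def lateChoice : Tm 0 := .lam (.lam (.choice (.var 1) (.var 0)))

/-- `(λx.λy.x) ⊕ (λx.λy.y)` -/
def earlyChoice : Tm 0 := .choice (.lam (.lam (.var 1))) (.lam (.lam (.var 0)))

end ProbLam

end

open scoped ENNReal

noncomputable section

namespace ProbLam

/-! ## Renaming and substitution -/

namespace Tm

/-! Everything factors through the CIU preorder, that is, through frame stacks used as tests. The
link with the big-step semantics is `stackConvProb_eq_tsum_sem`: running `M` on `S` amounts to
evaluating `M` and then running `S` on the resulting value, so the convergence probability is the
mean of a weight on values under `sem M`.

Similarity implies CIU by induction on the stack. If the weight on values is monotone along a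
simulation `R`, then `R` maps each superlevel set of the weight into itself, so the simulation
inequality compares the masses of all superlevel sets, and the layer-cake formula
(`tsum_mul_le_tsum_mul_of_superlevel`) compares the means. CIU implies the context preorder by
`Plug.stackEval_le`, an induction on the number of machine steps for terms and stacks with many
holes. Bisimilarity reduces to similarity, because a bisimulation is a simulation.

For strictness, a stack cannot separate `lateChoice` from `earlyChoice`: with fewer than two frames
both converge surely, and with two or more both continue with either of the first two arguments,
each with probability one half. A simulation, however, would have to relate `λy.(x ⊕ y)` to `λy.x`
as distinguished values, and passing a divergent `x` and then the identity refutes this. -/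

theorem rename_eq_subst {n : ℕ} (M : Tm n) :
    ∀ {m : ℕ} (ρ : Fin n → Fin m), M.rename ρ = M.subst (fun i => var (ρ i)) := by
  induction M with
  | var i => intro m ρ; rfl
  | lam M ih =>
    intro m ρ
    simp only [rename, subst, ih]
    congr 2
    funext i
    refine Fin.cases rfl (fun i => rfl) i
  | app M N ihM ihN => intro m ρ; simp only [rename, subst, ihM, ihN]
  | choice M N ihM ihN => intro m ρ; simp only [rename, subst, ihM, ihN]

theorem subst_rename {n : ℕ} (M : Tm n) :
    ∀ {m k : ℕ} (ρ : Fin n → Fin m) (σ : Fin m → Tm k),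
      (M.rename ρ).subst σ = M.subst (fun i => σ (ρ i)) := by
  induction M with
  | var i => intro m k ρ σ; rfl
  | lam M ih =>
    intro m k ρ σ
    simp only [rename, subst, ih]
    congr 2
    funext i
    refine Fin.cases rfl (fun i => rfl) i
  | app M N ihM ihN => intro m k ρ σ; simp only [rename, subst, ihM, ihN]
  | choice M N ihM ihN => intro m k ρ σ; simp only [rename, subst, ihM, ihN]

theorem rename_rename {n m k : ℕ} (M : Tm n) (ρ : Fin n → Fin m) (ρ' : Fin m → Fin k) :
    (M.rename ρ).rename ρ' = M.rename (fun i => ρ' (ρ i)) := by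
  rw [rename_eq_subst _ ρ', subst_rename, rename_eq_subst]

theorem rename_subst {n : ℕ} (M : Tm n) :
    ∀ {m k : ℕ} (σ : Fin n → Tm m) (ρ : Fin m → Fin k),
      (M.subst σ).rename ρ = M.subst (fun i => (σ i).rename ρ) := by
  induction M with
  | var i => intro m k σ ρ; rfl
  | lam M ih =>
    intro m k σ ρ
    simp only [rename, subst, ih]
    congr 2
    funext i
    refine Fin.cases rfl (fun i => ?_) i
    change ((σ i).rename Fin.succ).rename _ = ((σ i).rename ρ).rename Fin.succ
    rw [rename_rename, rename_rename]
    rfl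
  | app M N ihM ihN => intro m k σ ρ; simp only [rename, subst, ihM, ihN]
  | choice M N ihM ihN => intro m k σ ρ; simp only [rename, subst, ihM, ihN]

/-- Moving a substitution under a binder renames its terms, so the binder case rests on both mixed
laws, `subst_rename` and `rename_subst`. -/
theorem subst_subst {n : ℕ} (M : Tm n) :
    ∀ {m k : ℕ} (σ : Fin n → Tm m) (τ : Fin m → Tm k),
      (M.subst σ).subst τ = M.subst (fun i => (σ i).subst τ) := by
  induction M with
  | var i => intro m k σ τ; rfl
  | lam M ih =>
    intro m k σ τ
    simp only [subst, ih]
    congr 2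
    funext i
    refine Fin.cases rfl (fun i => ?_) i
    change ((σ i).rename Fin.succ).subst _ = ((σ i).subst τ).rename Fin.succ
    rw [subst_rename, rename_subst]
    rfl
  | app M N ihM ihN => intro m k σ τ; simp only [subst, ihM, ihN]
  | choice M N ihM ihN => intro m k σ τ; simp only [subst, ihM, ihN]

theorem subst_var {n : ℕ} (M : Tm n) : M.subst var = M := by
  induction M with
  | var i => rfl
  | @lam n M ih =>
    have e : up (var : Fin n → Tm n) = var := by
      funext i
      exact Fin.cases rfl (fun i => rfl) i
    rw [subst, e, ih]
  | app M N ihM ihN => simp only [subst, ihM, ihN]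
  | choice M N ihM ihN => simp only [subst, ihM, ihN]

theorem subst_closed (M : Tm 0) (σ : Fin 0 → Tm 0) : M.subst σ = M := by
  rw [Subsingleton.elim σ var, subst_var]

end Tm

/-! ## Evaluation with fuel -/

/-- The convergence probability of a stack configuration within `k` reduction steps. -/
def stackEval : ℕ → FrameStack → Tm 0 → ℝ≥0∞
  | 0, _, _ => 0
  | _ + 1, _, .var i => i.elim0
  | k + 1, S, .app M N => stackEval k (N :: S) M
  | k + 1, S, .choice M N => 2⁻¹ * (stackEval k S M + stackEval k S N)
  | _ + 1, [], .lam _ => 1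
  | k + 1, L :: S, .lam P => stackEval k S (P.inst L)

theorem stackEval_le_succ (k : ℕ) :
    ∀ (S : FrameStack) (M : Tm 0), stackEval k S M ≤ stackEval (k + 1) S M := by
  induction k with
  | zero => intro S M; exact zero_le
  | succ k ih =>
    intro S M
    cases M with
    | var i => exact i.elim0
    | app M N => exact ih _ _
    | choice M N =>
      simp only [stackEval]
      exact mul_le_mul' le_rfl (add_le_add (ih _ _) (ih _ _))
    | lam P =>
      cases S with
      | nil => simp [stackEval]
      | cons L S => exact ih _ _

theorem stackEval_mono (S : FrameStack) (M : Tm 0) : Monotone fun k => stackEval k S M :=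
  monotone_nat_of_le_succ fun k => stackEval_le_succ k S M

theorem stackEval_le_one (k : ℕ) :
    ∀ (S : FrameStack) (M : Tm 0), stackEval k S M ≤ 1 := by
  induction k with
  | zero => intro S M; exact zero_le
  | succ k ih =>
    intro S M
    cases M with
    | var i => exact i.elim0
    | app M N => exact ih _ _
    | choice M N =>
      calc 2⁻¹ * (stackEval k S M + stackEval k S N) ≤ 2⁻¹ * (1 + 1) :=
            mul_le_mul' le_rfl (add_le_add (ih _ _) (ih _ _))
        _ = (1 : ℝ≥0∞) := by
          rw [one_add_one_eq_two]; exact ENNReal.inv_mul_cancel (by simp) (by simp)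
    | lam P =>
      cases S with
      | nil => simp [stackEval]
      | cons L S => exact ih _ _

/-- Together with `StackConv.exists_le_stackEval` this makes the fuelled evaluator cofinal among the
derivable approximations, so the supremum may be taken over a monotone sequence. -/
theorem stackConv_stackEval (k : ℕ) :
    ∀ (S : FrameStack) (M : Tm 0), StackConv S M (stackEval k S M) := by
  induction k with
  | zero => intro S M; exact .empty S M
  | succ k ih =>
    intro S M
    cases M with
    | var i => exact i.elim0
    | app M N =>
      have h := StackConv.term _ _ _ (fun _ => stackEval k (N :: S) M) (StackStep.push S M N)
        (by intro i; obtain rfl : i = 0 := Subsingleton.elim (α := Fin 1) _ _; exact ih _ _)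
      simpa [stackEval] using h
    | choice M N =>
      have h := StackConv.term _ _ _ (![stackEval k S M, stackEval k S N])
        (StackStep.choice S M N)
        (by
          intro i
          change Fin 2 at i
          fin_cases i
          · exact ih _ _
          · exact ih _ _)
      have e : stackEval (k + 1) S (.choice M N) = ((2 : ℕ) : ℝ≥0∞)⁻¹ *
          ∑ i : Fin 2, (![stackEval k S M, stackEval k S N]) i := by
        simp [stackEval, Fin.sum_univ_two]
      rw [e]
      exact h
    | lam P =>
      cases S with
      | nil => exact .value P
      | cons L S =>
        have h := StackConv.term _ _ _ (fun _ => stackEval k S (P.inst L))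
          (StackStep.pop S L P)
          (by intro i; obtain rfl : i = 0 := Subsingleton.elim (α := Fin 1) _ _; exact ih _ _)
        simpa [stackEval] using h

theorem StackConv.exists_le_stackEval {S : FrameStack} {M : Tm 0} {p : ℝ≥0∞}
    (h : StackConv S M p) : ∃ k, p ≤ stackEval k S M := by
  induction h with
  | empty S M => exact ⟨0, le_rfl⟩
  | value P => exact ⟨1, le_rfl⟩
  | term S M cs p hs _ ih =>
    cases hs with
    | push S M N =>
      obtain ⟨k, hk⟩ := ih ⟨0, by simp⟩
      refine ⟨k + 1, ?_⟩
      simpa [stackEval] using hk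
    | choice S M N =>
      obtain ⟨k, hk⟩ := ih ⟨0, by simp⟩
      obtain ⟨l, hl⟩ := ih ⟨1, by simp⟩
      refine ⟨max k l + 1, ?_⟩
      have hk' := hk.trans (stackEval_mono _ _ (le_max_left k l))
      have hl' := hl.trans (stackEval_mono _ _ (le_max_right k l))
      have e : ((2 : ℕ) : ℝ≥0∞)⁻¹ * ∑ i : Fin 2, p i ≤ 2⁻¹ * (stackEval (max k l) S M
          + stackEval (max k l) S N) := by
        rw [Fin.sum_univ_two]
        exact mul_le_mul' (by simp) (add_le_add hk' hl')
      exact e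
    | pop S L P =>
      obtain ⟨k, hk⟩ := ih ⟨0, by simp⟩
      refine ⟨k + 1, ?_⟩
      simpa [stackEval] using hk

theorem stackConvProb_eq_iSup (S : FrameStack) (M : Tm 0) :
    stackConvProb S M = ⨆ k, stackEval k S M := by
  refine le_antisymm (iSup_le fun p => ?_) (iSup_le fun k => ?_)
  · obtain ⟨k, hk⟩ := p.2.exists_le_stackEval
    exact hk.trans (le_iSup (fun k => stackEval k S M) k)
  · exact le_iSup (fun p : {p : ℝ≥0∞ // StackConv S M p} => p.1) ⟨_, stackConv_stackEval k S M⟩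

theorem stackEval_le_stackConvProb (k : ℕ) (S : FrameStack) (M : Tm 0) :
    stackEval k S M ≤ stackConvProb S M := by
  rw [stackConvProb_eq_iSup]
  exact le_iSup (fun k => stackEval k S M) k

theorem stackConvProb_le_one (S : FrameStack) (M : Tm 0) : stackConvProb S M ≤ 1 := by
  rw [stackConvProb_eq_iSup]
  exact iSup_le fun k => stackEval_le_one k S M

/-- With the fuel in successor form, one machine step unfolds definitionally; the equations for the
individual term formers below rely on this. -/
theorem stackConvProb_eq_iSup_succ (S : FrameStack) (M : Tm 0) :
    stackConvProb S M = ⨆ k, stackEval (k + 1) S M := by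
  rw [stackConvProb_eq_iSup, (stackEval_mono S M).iSup_nat_add 1]

theorem stackConvProb_app (S : FrameStack) (M N : Tm 0) :
    stackConvProb S (.app M N) = stackConvProb (N :: S) M := by
  rw [stackConvProb_eq_iSup_succ, stackConvProb_eq_iSup]
  rfl

theorem stackConvProb_choice (S : FrameStack) (M N : Tm 0) :
    stackConvProb S (.choice M N) = 2⁻¹ * (stackConvProb S M + stackConvProb S N) := by
  rw [stackConvProb_eq_iSup_succ, stackConvProb_eq_iSup S M, stackConvProb_eq_iSup S N,
    ENNReal.iSup_add_iSup_of_monotone (stackEval_mono S M) (stackEval_mono S N),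
    ENNReal.mul_iSup]
  rfl

theorem stackConvProb_nil_lam (P : Val) : stackConvProb [] (.lam P) = 1 :=
  le_antisymm (stackConvProb_le_one _ _) (stackEval_le_stackConvProb 1 [] (.lam P))

theorem stackConvProb_cons_lam (L : Tm 0) (S : FrameStack) (P : Val) :
    stackConvProb (L :: S) (.lam P) = stackConvProb S (P.inst L) := by
  rw [stackConvProb_eq_iSup_succ, stackConvProb_eq_iSup]
  rfl

/-! ## Big-step semantics and stacks -/

open Classical in
/-- The big-step approximation of depth `k`. -/
def bigEval : ℕ → Tm 0 → Dist
  | 0, _ => 0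
  | _ + 1, .var i => i.elim0
  | _ + 1, .lam P => Pi.single P 1
  | k + 1, .app M N => fun V => ∑' P : Val, bigEval k M P * bigEval k (P.inst N) V
  | k + 1, .choice M N => fun V => 2⁻¹ * bigEval k M V + 2⁻¹ * bigEval k N V

theorem bigStep_bigEval (k : ℕ) : ∀ M : Tm 0, BigStep M (bigEval k M) := by
  induction k with
  | zero => intro M; exact .bt M
  | succ k ih =>
    intro M
    cases M with
    | var i => exact i.elim0
    | lam P => exact .bv P
    | app M N => exact .ba M N _ _ (ih M) fun P _ => ih _
    | choice M N => exact .bs M N _ _ (ih M) (ih N)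

theorem BigStep.le_sem {M : Tm 0} {D : Dist} (h : BigStep M D) (V : Val) : D V ≤ sem M V :=
  le_iSup (fun D : {D : Dist // BigStep M D} => D.1 V) ⟨D, h⟩

open Classical in
theorem tsum_pi_single_mul (P : Val) (w : Val → ℝ≥0∞) :
    ∑' V, (Pi.single P 1 : Dist) V * w V = w P := by
  rw [tsum_eq_single P (fun b hb => by simp [hb])]
  simp

theorem tsum_bind_mul (D : Dist) (E : Val → Dist) (w : Val → ℝ≥0∞) :
    ∑' V, (∑' P, D P * E P V) * w V = ∑' P, D P * ∑' V, E P V * w V := by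
  simp_rw [← ENNReal.tsum_mul_right, ← ENNReal.tsum_mul_left]
  rw [ENNReal.tsum_comm]
  simp_rw [mul_assoc]

theorem tsum_choice_mul (D E : Dist) (w : Val → ℝ≥0∞) :
    ∑' V, (2⁻¹ * D V + 2⁻¹ * E V) * w V = 2⁻¹ * (∑' V, D V * w V + ∑' V, E V * w V) := by
  simp_rw [add_mul, mul_assoc]
  rw [ENNReal.tsum_add, ENNReal.tsum_mul_left, ENNReal.tsum_mul_left, mul_add]

/-- A run of `k` steps splits into the evaluation of `M` and a run from the value reached, each of
which fits within the bound `k`. Reusing `k` for both is wasteful but harmless in the supremum. -/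
theorem stackEval_le_tsum_bigEval (k : ℕ) : ∀ (S : FrameStack) (M : Tm 0),
    stackEval k S M ≤ ∑' P, bigEval k M P * stackEval k S (.lam P) := by
  induction k with
  | zero => intro S M; exact zero_le
  | succ k ih =>
    intro S M
    cases M with
    | var i => exact i.elim0
    | lam P => exact (tsum_pi_single_mul P _).ge
    | app M N =>
      refine (ih (N :: S) M).trans ?_
      have e := tsum_bind_mul (bigEval k M) (fun P => bigEval k (P.inst N))
        (fun V => stackEval (k + 1) S (.lam V))
      refine le_of_le_of_eq ?_ e.symm
      refine ENNReal.tsum_le_tsum fun P => mul_le_mul' le_rfl ?_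
      -- The extra unit of fuel pays for popping `N`, after which the configuration is `P.inst N` on
      -- `S` with fuel `k` again.
      refine (stackEval_le_succ k (N :: S) (.lam P)).trans ((ih S (P.inst N)).trans ?_)
      exact ENNReal.tsum_le_tsum fun V => mul_le_mul' le_rfl (stackEval_le_succ _ _ _)
    | choice M N =>
      have e := tsum_choice_mul (bigEval k M) (bigEval k N)
        (fun V => stackEval (k + 1) S (.lam V))
      refine le_of_le_of_eq (mul_le_mul' le_rfl (add_le_add ?_ ?_)) e.symm
      · exact (ih S M).trans
          (ENNReal.tsum_le_tsum fun V => mul_le_mul' le_rfl (stackEval_le_succ _ _ _))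
      · exact (ih S N).trans
          (ENNReal.tsum_le_tsum fun V => mul_le_mul' le_rfl (stackEval_le_succ _ _ _))

theorem BigStep.tsum_mul_le_stackConvProb {M : Tm 0} {D : Dist} (h : BigStep M D) :
    ∀ S : FrameStack, ∑' P, D P * stackConvProb S (.lam P) ≤ stackConvProb S M := by
  classical
  induction h with
  | bt M => intro S; simp
  | bv P => intro S; exact (tsum_pi_single_mul P _).le
  | ba M N D E hM hE ihM ihE =>
    intro S
    rw [tsum_bind_mul, stackConvProb_app]
    refine le_trans (ENNReal.tsum_le_tsum fun P => ?_) (ihM (N :: S))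
    rw [stackConvProb_cons_lam]
    by_cases hP : D P = 0
    · simp [hP]
    · exact mul_le_mul' le_rfl (ihE P hP S)
  | bs M N D E hM hN ihM ihN =>
    intro S
    rw [tsum_choice_mul, stackConvProb_choice]
    exact mul_le_mul' le_rfl (add_le_add (ihM S) (ihN S))

/-- The approximations of `M` are directed, so their pointwise supremum commutes with finite sums.
-/
theorem tsum_sem_mul_le {M : Tm 0} {w : Val → ℝ≥0∞} {c : ℝ≥0∞}
    (h : ∀ D, BigStep M D → ∑' P, D P * w P ≤ c) : ∑' P, sem M P * w P ≤ c := by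
  rw [ENNReal.tsum_eq_iSup_sum]
  refine iSup_le fun s => ?_
  simp only [sem, ENNReal.iSup_mul]
  rw [ENNReal.finsetSum_iSup]
  · exact iSup_le fun D => (ENNReal.sum_le_tsum s).trans (h D.1 D.2)
  · intro D₁ D₂
    obtain ⟨D₃, h₃, a, b⟩ := D₁.2.directed D₂.2
    exact ⟨⟨D₃, h₃⟩, fun V => ⟨mul_le_mul' (a V) le_rfl, mul_le_mul' (b V) le_rfl⟩⟩

theorem stackConvProb_eq_tsum_sem (S : FrameStack) (M : Tm 0) :
    stackConvProb S M = ∑' P, sem M P * stackConvProb S (.lam P) := by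
  refine le_antisymm ?_ (tsum_sem_mul_le fun D hD => hD.tsum_mul_le_stackConvProb S)
  rw [stackConvProb_eq_iSup]
  refine iSup_le fun k => (stackEval_le_tsum_bigEval k S M).trans ?_
  exact ENNReal.tsum_le_tsum fun P =>
    mul_le_mul' ((bigStep_bigEval k M).le_sem P) (stackEval_le_stackConvProb _ _ _)

theorem convProb_eq_stackConvProb (M : Tm 0) : convProb M = stackConvProb [] M := by
  rw [stackConvProb_eq_tsum_sem, convProb]
  simp [stackConvProb_nil_lam]

/-! ## The context lemma -/

/-- `Plug M N T T'`: the terms `T` and `T'` arise from a term with any number of holes, by plugging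
in substitution instances of `M` and of `N`, where substitutions are related in the same way. -/
inductive Plug {n : ℕ} (M N : Tm n) : ∀ {m : ℕ}, Tm m → Tm m → Prop
  | var {m : ℕ} (i : Fin m) : Plug M N (.var i) (.var i)
  | lam {m : ℕ} {P P' : Tm (m + 1)} : Plug M N P P' → Plug M N (.lam P) (.lam P')
  | app {m : ℕ} {P P' Q Q' : Tm m} :
      Plug M N P P' → Plug M N Q Q' → Plug M N (.app P Q) (.app P' Q')
  | choice {m : ℕ} {P P' Q Q' : Tm m} :
      Plug M N P P' → Plug M N Q Q' → Plug M N (.choice P Q) (.choice P' Q')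
  | hole {m : ℕ} {σ τ : Fin n → Tm m} :
      (∀ i, Plug M N (σ i) (τ i)) → Plug M N (M.subst σ) (N.subst τ)

namespace Plug

variable {n : ℕ} {M N : Tm n}

theorem refl {m : ℕ} (T : Tm m) : Plug M N T T := by
  induction T with
  | var i => exact .var i
  | lam P ih => exact .lam ih
  | app P Q ihP ihQ => exact .app ihP ihQ
  | choice P Q ihP ihQ => exact .choice ihP ihQ

theorem rename {m : ℕ} {T T' : Tm m} (h : Plug M N T T') :
    ∀ {k : ℕ} (ρ : Fin m → Fin k), Plug M N (T.rename ρ) (T'.rename ρ) := by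
  induction h with
  | var i => intro k ρ; exact .var _
  | lam _ ih => intro k ρ; exact .lam (ih _)
  | app _ _ ihP ihQ => intro k ρ; exact .app (ihP ρ) (ihQ ρ)
  | choice _ _ ihP ihQ => intro k ρ; exact .choice (ihP ρ) (ihQ ρ)
  | hole _ ih =>
    intro k ρ
    rw [Tm.rename_subst, Tm.rename_subst]
    exact .hole fun i => ih i ρ

theorem up {m k : ℕ} {σ τ : Fin m → Tm k} (h : ∀ i, Plug M N (σ i) (τ i)) (i : Fin (m + 1)) :
    Plug M N (Tm.up σ i) (Tm.up τ i) :=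
  Fin.cases (.var 0) (fun i => (h i).rename Fin.succ) i

/-- This is why holes carry a pair of related substitutions: a β-step substitutes into the terms at
the holes, and the composite substitutions are again related. -/
theorem subst {m : ℕ} {T T' : Tm m} (h : Plug M N T T') :
    ∀ {k : ℕ} {σ τ : Fin m → Tm k}, (∀ i, Plug M N (σ i) (τ i)) →
      Plug M N (T.subst σ) (T'.subst τ) := by
  induction h with
  | var i => intro k σ τ hσ; exact hσ i
  | lam _ ih => intro k σ τ hσ; exact .lam (ih (up hσ))
  | app _ _ ihP ihQ => intro k σ τ hσ; exact .app (ihP hσ) (ihQ hσ)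
  | choice _ _ ihP ihQ => intro k σ τ hσ; exact .choice (ihP hσ) (ihQ hσ)
  | hole _ ih =>
    intro k σ τ hσ
    rw [Tm.subst_subst, Tm.subst_subst]
    exact .hole fun i => ih i hσ

/-- A hole that captures variables is a substitution by variables, so contexts with capture need no
separate treatment. -/
theorem fill {m : ℕ} (C : Ctx n m) : Plug M N (C.fill M) (C.fill N) := by
  induction C with
  | hole ρ =>
    simp only [Ctx.fill]
    rw [Tm.rename_eq_subst, Tm.rename_eq_subst]
    exact .hole fun i => .var _
  | lam C ih => exact .lam ih
  | appL C T ih => exact .app ih (refl T)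
  | appR T C ih => exact .app (refl T) ih
  | choiceL C T ih => exact .choice ih (refl T)
  | choiceR T C ih => exact .choice (refl T) ih

/-- The outer induction is on fuel, the inner one on the derivation of `Plug`. The scope `m` is tied
to `0` by an equation so that the inner induction can range over the indexed family. -/
theorem stackEval_le (h : openExt ciuLE n M N) (k : ℕ) :
    ∀ {m : ℕ} {T T' : Tm m}, Plug M N T T' → ∀ (e : m = 0) {S S' : FrameStack},
      List.Forall₂ (Plug M N) S S' → stackEval k S (e ▸ T) ≤ stackConvProb S' (e ▸ T') := by
  induction k with
  | zero => intros; exact zero_le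
  | succ k ih =>
    have hlam : ∀ {P P' : Tm 1} {S S' : FrameStack}, Plug M N P P' →
        List.Forall₂ (Plug M N) S S' →
        stackEval (k + 1) S (.lam P) ≤ stackConvProb S' (.lam P') := by
      intro P P' S S' hP hS
      cases hS with
      | nil => rw [stackConvProb_nil_lam]; exact stackEval_le_one _ _ _
      | cons hL hS =>
        rw [stackConvProb_cons_lam]
        exact ih (hP.subst fun _ => hL) rfl hS
    have happ : ∀ {P P' Q Q' : Tm 0} {S S' : FrameStack}, Plug M N P P' → Plug M N Q Q' →
        List.Forall₂ (Plug M N) S S' →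
        stackEval (k + 1) S (.app P Q) ≤ stackConvProb S' (.app P' Q') := by
      intro P P' Q Q' S S' hP hQ hS
      rw [stackConvProb_app]
      exact ih hP rfl (.cons hQ hS)
    have hchoice : ∀ {P P' Q Q' : Tm 0} {S S' : FrameStack}, Plug M N P P' → Plug M N Q Q' →
        List.Forall₂ (Plug M N) S S' →
        stackEval (k + 1) S (.choice P Q) ≤ stackConvProb S' (.choice P' Q') := by
      intro P P' Q Q' S S' hP hQ hS
      rw [stackConvProb_choice]
      exact mul_le_mul' le_rfl (add_le_add (ih hP rfl hS) (ih hQ rfl hS))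
    intro m T T' hT
    induction hT with
    | var i => intro e; subst e; exact i.elim0
    | lam hP _ => intro e S S' hS; subst e; exact hlam hP hS
    | app hP hQ _ _ => intro e S S' hS; subst e; exact happ hP hQ hS
    | choice hP hQ _ _ => intro e S S' hS; subst e; exact hchoice hP hQ hS
    | @hole m σ τ hσ ihσ =>
      intro e S S' hS
      subst e
      -- The CIU hypothesis replaces `N` by `M` on the right, so only the substitutions and stacks
      -- still differ. If `M` is a variable, the inner hypothesis applies to the substituted terms;
      -- otherwise its outermost constructor is exposed and the step it takes lowers the fuel.
      refine le_trans ?_ (h τ S')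
      have key : ∀ Q : Tm n,
          stackEval (k + 1) S (Q.subst σ) ≤ stackConvProb S' (Q.subst τ) := by
        intro Q
        cases Q with
        | var i => exact ihσ i rfl hS
        | lam P => exact hlam ((refl P).subst (up hσ)) hS
        | app P Q => exact happ ((refl P).subst hσ) ((refl Q).subst hσ) hS
        | choice P Q => exact hchoice ((refl P).subst hσ) ((refl Q).subst hσ) hS
      exact key M

end Plug

theorem ctxLE_of_openExt_ciuLE {n : ℕ} {M N : Tm n} (h : openExt ciuLE n M N) :
    ctxLE n M N := by
  intro C
  rw [convProb_eq_stackConvProb, convProb_eq_stackConvProb, stackConvProb_eq_iSup]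
  exact iSup_le fun k => Plug.stackEval_le h k (Plug.fill C) rfl .nil

theorem ctxLE_of_ciuLE {M N : Tm 0} (h : ciuLE M N) : ctxLE 0 M N :=
  ctxLE_of_openExt_ciuLE fun σ => by rwa [Tm.subst_closed, Tm.subst_closed]

/-! ## Similarity implies the CIU preorder -/

/-- Comparison of weighted sums by comparison on the strict superlevel sets of the weight. -/
theorem tsum_mul_le_tsum_mul_of_superlevel {α : Type*} [Countable α] {μ ν g : α → ℝ≥0∞}
    (hg : ∀ a, g a ≠ ∞)
    (h : ∀ c : ℝ≥0∞, ∑' a, {a | c < g a}.indicator μ a ≤ ∑' a, {a | c < g a}.indicator ν a) :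
    ∑' a, μ a * g a ≤ ∑' a, ν a * g a := by
  -- Layer-cake formula: `g a` is the length of the set of `t ≥ 0` lying below it, and sum and
  -- integral are exchanged.
  have key : ∀ κ : α → ℝ≥0∞, ∑' a, κ a * g a =
      ∫⁻ t in Set.Ici (0 : ℝ), ∑' a, {a | ENNReal.ofReal t < g a}.indicator κ a := by
    intro κ
    have hind : ∀ a, (fun t : ℝ => {a | ENNReal.ofReal t < g a}.indicator κ a) =
        {t : ℝ | ENNReal.ofReal t < g a}.indicator (fun _ => κ a) := by
      intro a; funext t; simp [Set.indicator]
    have hmeas : ∀ a, MeasurableSet {t : ℝ | ENNReal.ofReal t < g a} := fun a =>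
      measurableSet_lt ENNReal.measurable_ofReal measurable_const
    rw [MeasureTheory.lintegral_tsum]
    · refine tsum_congr fun a => ?_
      rw [hind, MeasureTheory.lintegral_indicator (hmeas a), MeasureTheory.lintegral_const,
        MeasureTheory.Measure.restrict_apply_univ,
        MeasureTheory.Measure.restrict_apply (hmeas a)]
      have hset : {t : ℝ | ENNReal.ofReal t < g a} ∩ Set.Ici 0 = Set.Ico 0 (g a).toReal := by
        ext t
        simp only [Set.mem_inter_iff, Set.mem_ofPred_eq, Set.mem_Ici, Set.mem_Ico]
        constructor
        · rintro ⟨h₁, h₂⟩; exact ⟨h₂, (ENNReal.ofReal_lt_iff_lt_toReal h₂ (hg a)).1 h₁⟩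
        · rintro ⟨h₁, h₂⟩; exact ⟨(ENNReal.ofReal_lt_iff_lt_toReal h₁ (hg a)).2 h₂, h₁⟩
      rw [hset, Real.volume_Ico, sub_zero, ENNReal.ofReal_toReal (hg a)]
    · intro a
      rw [hind]
      exact (measurable_const.indicator (hmeas a)).aemeasurable
  rw [key μ, key ν]
  exact MeasureTheory.lintegral_mono fun t => h _

theorem LMC.prob_eq_tsum_indicator {S L : Type} [Countable S] (K : LMC S L) (s : S) (l : L)
    (X : Set S) : K.prob s l X = ∑' t, X.indicator (K.P s l) t :=
  tsum_subtype X (K.P s l)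

theorem prob_inl_tau (M : Tm 0) (X : Set State) :
    lambdaChain.prob (.inl M) .tau X = ∑' P, {P | Sum.inr P ∈ X}.indicator (sem M) P := by
  classical
  rw [LMC.prob_eq_tsum_indicator, Summable.tsum_sum ENNReal.summable ENNReal.summable]
  simp [Set.indicator, lambdaChain, trans]

theorem prob_inr_arg (P : Val) (L : Tm 0) (X : Set State) [Decidable (.inl (P.inst L) ∈ X)] :
    lambdaChain.prob (.inr P) (.arg L) X = if Sum.inl (P.inst L) ∈ X then 1 else 0 := by
  classical
  rw [LMC.prob_eq_tsum_indicator, tsum_eq_single (Sum.inl (P.inst L))]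
  · simp [Set.indicator, lambdaChain, trans]
  · rintro (Q | V) hb
    · have : Q ≠ P.inst L := fun h => hb (by rw [h])
      simp [Set.indicator, lambdaChain, trans, this]
    · simp [Set.indicator, lambdaChain, trans]

section Simulation

variable {R : State → State → Prop}

/-- Parameter passing is deterministic, so the inequality for a singleton reads `1 ≤ 0` unless the
two targets are related. -/
theorem IsSimulation.inst (hR : lambdaChain.IsSimulation R) {P Q : Val}
    (h : R (.inr P) (.inr Q)) (L : Tm 0) : R (.inl (P.inst L)) (.inl (Q.inst L)) := by
  classical
  have := hR.step _ _ h (.arg L) {Sum.inl (P.inst L)}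
  rw [prob_inr_arg, prob_inr_arg] at this
  by_contra hn
  simp [hn] at this

theorem IsSimulation.tau (hR : lambdaChain.IsSimulation R) {M N : Tm 0}
    (h : R (.inl M) (.inl N)) (A : Set Val) :
    ∑' P, A.indicator (sem M) P ≤
      ∑' Q, {Q | ∃ P ∈ A, R (.inr P) (.inr Q)}.indicator (sem N) Q := by
  have := hR.step _ _ h .tau (Sum.inr '' A)
  rw [prob_inl_tau, prob_inl_tau] at this
  convert this using 5
  · simp
  · simp

theorem IsSimulation.stackConvProb_le_of_lam (hR : lambdaChain.IsSimulation R) {S : FrameStack}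
    (hS : ∀ P Q : Val, R (.inr P) (.inr Q) →
      stackConvProb S (.lam P) ≤ stackConvProb S (.lam Q))
    {M N : Tm 0} (h : R (.inl M) (.inl N)) : stackConvProb S M ≤ stackConvProb S N := by
  rw [stackConvProb_eq_tsum_sem S M, stackConvProb_eq_tsum_sem S N]
  refine tsum_mul_le_tsum_mul_of_superlevel
    (fun P => ((stackConvProb_le_one _ _).trans_lt ENNReal.one_lt_top).ne) fun c => ?_
  refine (IsSimulation.tau hR h _).trans (ENNReal.tsum_le_tsum fun Q => ?_)
  -- By `hS` the superlevel set contains its own image under `R`.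
  refine Set.indicator_le_indicator_of_subset ?_ (fun _ => zero_le) Q
  rintro Q ⟨P, hP, hPQ⟩
  exact lt_of_lt_of_le hP (hS P Q hPQ)

theorem IsSimulation.ciuLE (hR : lambdaChain.IsSimulation R) {M N : Tm 0}
    (h : R (.inl M) (.inl N)) : ciuLE M N := by
  intro S
  induction S generalizing M N with
  | nil =>
    exact stackConvProb_le_of_lam hR
      (fun P Q _ => by rw [stackConvProb_nil_lam, stackConvProb_nil_lam]) h
  | cons L S ih =>
    refine stackConvProb_le_of_lam hR (fun P Q hPQ => ?_) h
    rw [stackConvProb_cons_lam, stackConvProb_cons_lam]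
    exact ih (IsSimulation.inst hR hPQ L)

end Simulation

theorem similar.ciuLE {M N : Tm 0} (h : similar M N) : ciuLE M N := by
  obtain ⟨R, hR, -, h⟩ := h
  exact IsSimulation.ciuLE hR h

/-! ## Bisimulations are simulations -/

theorem LMC.prob_mono {S L : Type} [Countable S] (K : LMC S L) (s : S) (l : L) {X Y : Set S}
    (h : X ⊆ Y) : K.prob s l X ≤ K.prob s l Y := by
  rw [LMC.prob_eq_tsum_indicator, LMC.prob_eq_tsum_indicator]
  exact ENNReal.tsum_le_tsum fun t =>
    Set.indicator_le_indicator_of_subset h (fun _ => zero_le) t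

/-- The probability of a saturated set is the sum of the probabilities of its classes. -/
theorem LMC.prob_saturated {S L : Type} [Countable S] (K : LMC S L) (r : Setoid S) (s : S) (l : L)
    (Y : Set (Quotient r)) :
    K.prob s l (Quotient.mk r ⁻¹' Y) =
      ∑' q, Y.indicator (fun q => K.prob s l (Quotient.mk r ⁻¹' {q})) q := by
  rw [LMC.prob_eq_tsum_indicator, ← (Equiv.sigmaFiberEquiv (Quotient.mk r)).tsum_eq,
    ENNReal.tsum_sigma']
  refine tsum_congr fun q => ?_
  by_cases hq : q ∈ Y
  · rw [Set.indicator_of_mem hq, LMC.prob]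
    refine tsum_congr fun t => ?_
    rw [Set.indicator_of_mem]
    · rfl
    · change Quotient.mk r t.1 ∈ Y
      rw [t.2]
      exact hq
  · rw [Set.indicator_of_notMem hq]
    refine ENNReal.tsum_eq_zero.2 fun t => Set.indicator_of_notMem ?_ _
    change Quotient.mk r t.1 ∉ Y
    rw [t.2]
    exact hq

/-- The image `R(X)` is the union of the classes meeting `X`. It contains `X`, and its mass, a sum
over classes, is the same from both states. -/
theorem LMC.IsBisimulation.isSimulation {S L : Type} [Countable S] {K : LMC S L}
    {R : S → S → Prop} (h : K.IsBisimulation R) : K.IsSimulation R where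
  refl := h.equiv.refl
  trans _ _ _ := h.equiv.trans
  step s t hst l X := by
    let r : Setoid S := ⟨R, h.equiv⟩
    have e : {y | ∃ x ∈ X, R x y} = Quotient.mk r ⁻¹' (Quotient.mk r '' X) := by
      ext y
      simp only [Set.mem_ofPred_eq, Set.mem_preimage, Set.mem_image]
      exact exists_congr fun x => and_congr_right fun _ => (Quotient.eq (r := r)).symm
    have hclass : ∀ q : Quotient r, K.prob s l (Quotient.mk r ⁻¹' {q}) =
        K.prob t l (Quotient.mk r ⁻¹' {q}) := by
      intro q
      induction q using Quotient.inductionOn with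
      | h u =>
        have e : Quotient.mk r ⁻¹' {Quotient.mk r u} = {v | R u v} := by
          ext v
          exact (Quotient.eq (r := r)).trans ⟨h.equiv.symm, h.equiv.symm⟩
        rw [e]
        exact h.step s t hst l u
    calc K.prob s l X ≤ K.prob s l {y | ∃ x ∈ X, R x y} :=
          K.prob_mono s l fun x hx => ⟨x, hx, h.equiv.refl x⟩
      _ = K.prob t l {y | ∃ x ∈ X, R x y} := by
        rw [e, K.prob_saturated, K.prob_saturated]
        simp_rw [hclass]

theorem bisimilar.similar {M N : Tm 0} (h : bisimilar M N) : similar M N := by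
  obtain ⟨R, hR, hs, h⟩ := h
  exact ⟨R, hR.isSimulation, hs, h⟩

theorem bisimilar.symm {M N : Tm 0} (h : bisimilar M N) : bisimilar N M := by
  obtain ⟨R, hR, hs, h⟩ := h
  exact ⟨R, hR, hs, hR.equiv.symm h⟩

/-! ## Late and early choice -/

theorem stackConvProb_lateChoice (S : FrameStack) :
    stackConvProb S lateChoice = stackConvProb S earlyChoice := by
  have half : ∀ a : ℝ≥0∞, 2⁻¹ * (a + a) = a := fun a => by
    rw [← two_mul, ← mul_assoc, ENNReal.inv_mul_cancel (by simp) (by simp), one_mul]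
  rw [earlyChoice, lateChoice, stackConvProb_choice]
  -- With no frame or one frame, every run ends in an abstraction; with two or more, both sides
  -- become the average of `L` and `L'` run on the remaining stack.
  rcases S with _ | ⟨L, _ | ⟨L', S⟩⟩
  · simp only [stackConvProb_nil_lam, half]
  · simp only [stackConvProb_cons_lam, Tm.inst, Tm.subst, stackConvProb_nil_lam, half]
  · simp only [stackConvProb_cons_lam, Tm.inst, Tm.subst, stackConvProb_choice]

/-- The divergent term `(λx.xx)(λx.xx)`. -/
def omega : Tm 0 :=
  .app (.lam (.app (.var 0) (.var 0))) (.lam (.app (.var 0) (.var 0)))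

theorem stackEval_omega (S : FrameStack) (k : ℕ) : stackEval k S omega = 0 := by
  induction k using Nat.strong_induction_on with
  | _ k ih =>
    match k, ih with
    | 0, _ => rfl
    | 1, _ => rfl
    -- Two steps, a push and a pop, lead from `omega` back to itself on the same stack.
    | k + 2, ih => exact ih k (by omega)

theorem stackConvProb_omega (S : FrameStack) : stackConvProb S omega = 0 := by
  rw [stackConvProb_eq_iSup]
  simp [stackEval_omega]

theorem sem_lam_self (P : Val) : 1 ≤ sem (.lam P) P := by
  classical
  simpa using (BigStep.bv P).le_sem P

theorem half_le_sem_choice_lam (P Q : Val) : 2⁻¹ ≤ sem (.choice (.lam P) (.lam Q)) P := by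
  classical
  refine le_trans ?_ ((BigStep.bs _ _ _ _ (.bv P) (.bv Q)).le_sem P)
  simp

theorem not_similar_lateChoice_earlyChoice : ¬ similar lateChoice earlyChoice := by
  classical
  rintro ⟨R, hR, -, h⟩
  set A : Val := .lam (.choice (.var 1) (.var 0)) with hA
  set B : Val := .lam (.var 1) with hB
  -- `lateChoice` reaches `A` with probability one, so `earlyChoice` must put mass one on `R({A})`.
  -- It also puts at least one half on `B`; were `B` outside `R({A})`, its total mass would exceed
  -- one.
  have hAB : R (.inr A) (.inr B) := by
    by_contra hn
    have h₁ := IsSimulation.tau hR h {A}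
    set μ := sem earlyChoice with hμ
    have h₂ : ∑' Q, {Q | ∃ P ∈ ({A} : Set Val), R (.inr P) (.inr Q)}.indicator μ Q + μ B ≤ 1 := by
      have hsingle : μ B = ∑' Q, ({B} : Set Val).indicator μ Q := by
        rw [tsum_eq_single B (fun b hb => by simp [hb])]
        simp
      rw [hsingle, ← ENNReal.tsum_add]
      refine le_trans (ENNReal.tsum_le_tsum fun Q => ?_) (sum_sem_le_one earlyChoice)
      by_cases hQ : Q = B
      · subst hQ
        simp [hn, hμ]
      · simp only [Set.indicator, Set.mem_singleton_iff, hQ, if_false, add_zero]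
        split_ifs
        · exact le_rfl
        · exact zero_le
    have h₃ : 1 ≤ ∑' P, ({A} : Set Val).indicator (sem lateChoice) P := by
      refine le_trans ?_ (ENNReal.le_tsum A)
      rw [Set.indicator_of_mem (Set.mem_singleton A)]
      exact sem_lam_self A
    have h₄ : (1 : ℝ≥0∞) + 2⁻¹ ≤ 1 :=
      (add_le_add (h₃.trans h₁) (half_le_sem_choice_lam B _)).trans h₂
    exact absurd h₄ (not_le.2 (ENNReal.lt_add_right ENNReal.one_ne_top (by simp)))
  -- With `x` divergent and the identity passed for `y`, the left side converges with probability
  -- one half and the right side never does.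
  have h₁ := IsSimulation.ciuLE hR (IsSimulation.inst hR hAB omega) [.lam (.var 0)]
  have hl : stackConvProb [.lam (.var 0)] (A.inst omega) =
      2⁻¹ * (stackConvProb [] omega + stackConvProb [] (.lam (.var 0))) := by
    simp only [hA, Tm.inst, Tm.subst, stackConvProb_cons_lam, stackConvProb_choice]
    rfl
  have hr : stackConvProb [.lam (.var 0)] (B.inst omega) = stackConvProb [] omega := by
    simp only [hB, Tm.inst, Tm.subst, stackConvProb_cons_lam]
    rfl
  rw [hl, hr, stackConvProb_omega, stackConvProb_nil_lam] at h₁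
  simp at h₁

theorem ctxEquiv_lateChoice_earlyChoice : ctxEquiv 0 lateChoice earlyChoice :=
  ⟨ctxLE_of_ciuLE fun S => (stackConvProb_lateChoice S).le,
    ctxLE_of_ciuLE fun S => (stackConvProb_lateChoice S).ge⟩

end ProbLam

end

theorem mainTheorem6 :
    ((∀ (n : ℕ) (M N : ProbLam.Tm n),
        ProbLam.openExt ProbLam.similar n M N → ProbLam.ctxLE n M N) ∧
      (∃ M N : ProbLam.Tm 0, ProbLam.ctxLE 0 M N ∧ ¬ ProbLam.similar M N)) ∧
    ((∀ (n : ℕ) (M N : ProbLam.Tm n),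
        ProbLam.openExt ProbLam.bisimilar n M N → ProbLam.ctxEquiv n M N) ∧
      (∃ M N : ProbLam.Tm 0, ProbLam.ctxEquiv 0 M N ∧ ¬ ProbLam.bisimilar M N)) ∧
    ProbLam.ciuLE ProbLam.lateChoice ProbLam.earlyChoice ∧
    ProbLam.ctxLE 0 ProbLam.lateChoice ProbLam.earlyChoice ∧
    ¬ ProbLam.similar ProbLam.lateChoice ProbLam.earlyChoice := by
  open ProbLam in
  have hsound : ∀ (n : ℕ) (M N : Tm n), openExt similar n M N → ctxLE n M N :=
    fun n M N h => ctxLE_of_openExt_ciuLE fun σ => (h σ).ciuLE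
  open ProbLam in
  exact ⟨⟨hsound, lateChoice, earlyChoice, ctxEquiv_lateChoice_earlyChoice.1,
      not_similar_lateChoice_earlyChoice⟩,
    ⟨fun n M N h => ⟨hsound n M N fun σ => (h σ).similar, hsound n N M fun σ => (h σ).symm.similar⟩,
      lateChoice, earlyChoice, ctxEquiv_lateChoice_earlyChoice,
      fun h => not_similar_lateChoice_earlyChoice h.similar⟩,
    fun S => (stackConvProb_lateChoice S).le, ctxEquiv_lateChoice_earlyChoice.1,
    not_similar_lateChoice_earlyChoice⟩
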